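/- Let $n\ge 1$, let $e_1,\dots,e_n$ be the standard basis of $\mathbb R^n$, $\mathbf 1=(1,\dots,1)$, and for $\emptyset\ne T\subseteq[n]$ let $\Delta_T=\operatorname{conv}(e_i\mid i\in T)$. Let $\mathbf P=(\Delta_T)_{\emptyset\neq T\subseteq[n]}$, $P=\sum_{T}\Delta_T$ (Minkowski sum), and let $\mathrm{Cone}(P)^*=\{v\in\mathbb R^n\mid \langle v,y\rangle\ge 0\text{ for all }y\in P\}$. For $v\in\mathbb R^n$ put $h_{\Delta_T}(v)=-\min_{y\in\Delta_T}\langle v,y\rangle$ and, for variables $x=(x_T)_{\emptyset\ne T\subseteq[n]}$ and $z=(z_1,\dots,z_n)$, $h_{x\mathbf P-z}(v)=\sum_T x_T h_{\Delta_T}(v)+\langle v,z\rangle$. Triangulations of the boundary of $\mathrm{Cone}(P)^*$ exist; here a triangulation is a finite set $\mathcal T$ of $(n-1)$-dimensional simplicial cones whose union is that boundary, whose rays are extreme rays of $\mathrm{Cone}(P)^*$, and any two of which meet in a common face. Choose a generator of each ray of $\mathcal T$. The hyperplane dual mixed volume function of the generalized permutohedron $x\mathbf P=\sum_T x_T\Delta_T$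 is the rational function $$\tilde m_{\mathbf P}(x,z)=\sum_{F=\mathrm{span}_{\ge0}(v_1,\dots,v_{n-1})\in\mathcal T}\frac{|\det(v_1,\dots,v_{n-1},\mathbf 1)|}{\prod_{i=1}^{n-1}h_{x\mathbf P-z}(v_i)} .$$ Then, for every such $\mathcal T$ and every choice of generators, $\tilde m_{\mathbf P}$ can be restricted to $z=0$, $\langle x,\mathbf 1\rangle=\sum_T x_T=0$ (that is, one may substitute $z=0$ and $x_{[n]}=-\sum_{\emptyset\ne T\subsetneq[n]}x_T$), and as rational functions in the variables $x_T$, $\emptyset\neq T\subsetneq[n]$, $$\tilde m_{\mathbf P}(x,0)\big|_{\langle x,\mathbf 1\rangle=0}=(-1)^{n-1}\sum_{\sigma\in S_n}\ \prod_{a=1}^{n-1}\frac{1}{\sum_{\emptyset\ne T\subseteq\sigma[1:a]}x_T},$$ where $\sigma[1:a]=\{\sigma(1),\dots,\sigma(a)\}$. -/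

import Mathlib

open scoped Pointwise

noncomputable section

/-- Support function with the sign convention `h_S(v) = - min_{y ∈ S} ⟨v, y⟩`
(`sInf` is a minimum when `S` is nonempty and compact). -/
def supportFn {d : ℕ} (S : Set (Fin d → ℝ)) (v : Fin d → ℝ) : ℝ :=
  -sInf ((fun y => v ⬝ᵥ y) '' S)

/-- The cone over `S`: all `t • y` with `y ∈ S` and `t ≥ 0`. -/
def coneOver {d : ℕ} (S : Set (Fin d → ℝ)) : Set (Fin d → ℝ) :=
  {u | ∃ t : ℝ, 0 ≤ t ∧ ∃ y ∈ S, u = t • y}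

/-- The dual cone `C* = {v | ⟨v, y⟩ ≥ 0 for all y ∈ C}`. -/
def dualCone {d : ℕ} (C : Set (Fin d → ℝ)) : Set (Fin d → ℝ) :=
  {v | ∀ y ∈ C, 0 ≤ v ⬝ᵥ y}

/-- `v` generates an extreme ray (a one-dimensional face) of `C`. -/
def IsExtremeRayGenerator {d : ℕ} (C : Set (Fin d → ℝ)) (v : Fin d → ℝ) : Prop :=
  v ≠ 0 ∧ IsExposed ℝ C {u | ∃ t : ℝ, 0 ≤ t ∧ u = t • v}

/-- The simplicial cone spanned by a tuple of vectors, as a set. -/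
def spanCone {d k : ℕ} (F : Fin k → Fin d → ℝ) : Set (Fin d → ℝ) :=
  (PointedCone.hull ℝ (Set.range F) : Set (Fin d → ℝ))

/-- `𝒯` is a triangulation of the boundary of the cone `C ⊆ ℝ^d`, with a choice of ray generators.
Each top-dimensional (that is, `(d-1)`-dimensional) simplicial cone of the triangulation is listed
once, as the tuple of its `d - 1` generators in some order. -/
structure IsBoundaryTriangulation {d : ℕ} (C : Set (Fin d → ℝ))
    (𝒯 : Finset (Fin (d - 1) → Fin d → ℝ)) : Prop where
  /-- every cone is simplicial of dimension `d - 1` -/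
  linearIndependent : ∀ F ∈ 𝒯, LinearIndependent ℝ F
  /-- the rays of every cone are extreme rays of `C` -/
  extreme : ∀ F ∈ 𝒯, ∀ i, IsExtremeRayGenerator C (F i)
  /-- one generator is chosen for each ray -/
  generator_unique : ∀ F ∈ 𝒯, ∀ G ∈ 𝒯, ∀ i j, SameRay ℝ (F i) (G j) → F i = G j
  /-- no cone is listed twice -/
  cone_injOn : Set.InjOn spanCone (𝒯 : Set (Fin (d - 1) → Fin d → ℝ))
  /-- the cones cover exactly the boundary -/
  iUnion_eq : ⋃ F ∈ 𝒯, spanCone F = frontier C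
  /-- any two cones meet in a common face -/
  inter_face : ∀ F ∈ 𝒯, ∀ G ∈ 𝒯, IsExposed ℝ (spanCone F) (spanCone F ∩ spanCone G)

/-- The matrix with rows `v_1, …, v_{d-1}, 𝟏`. -/
def rowsWithOne {d : ℕ} (F : Fin (d - 1) → Fin d → ℝ) : Matrix (Fin d) (Fin d) ℝ :=
  Matrix.of fun i => if h : (i : ℕ) < d - 1 then F ⟨i, h⟩ else 1

/-- The linear form `h_{xP - z}(v) = ∑ i, x_i h_{P_i}(v) + ⟨v, z⟩` in the variables
`x_i = X (inl i)` and `z_j = X (inr j)`. -/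
def mixedSupportForm {d : ℕ} {ι : Type} [Fintype ι] (P : ι → Set (Fin d → ℝ))
    (v : Fin d → ℝ) : MvPolynomial (ι ⊕ Fin d) ℝ :=
  (∑ i, MvPolynomial.C (supportFn (P i) v) * MvPolynomial.X (Sum.inl i)) +
    ∑ j, MvPolynomial.C (v j) * MvPolynomial.X (Sum.inr j)

/-- The hyperplane dual mixed volume function of `P = (P_i)`, a rational function in `x` and `z`,
computed from the triangulation `𝒯` of the boundary of `Cone(∑ P_i)*`. -/
def hyperplaneDualMixedVolume {d : ℕ} {ι : Type} [Fintype ι] (P : ι → Set (Fin d → ℝ))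
    (𝒯 : Finset (Fin (d - 1) → Fin d → ℝ)) : FractionRing (MvPolynomial (ι ⊕ Fin d) ℝ) :=
  ∑ F ∈ 𝒯,
    algebraMap (MvPolynomial (ι ⊕ Fin d) ℝ) (FractionRing (MvPolynomial (ι ⊕ Fin d) ℝ))
        (MvPolynomial.C |(rowsWithOne F).det|) /
      ∏ j, algebraMap (MvPolynomial (ι ⊕ Fin d) ℝ) (FractionRing (MvPolynomial (ι ⊕ Fin d) ℝ))
        (mixedSupportForm P (F j))

/-- The rational function `f` is defined under the substitution `φ` and becomes `g`: one can write
`f = p / q` with `φ q ≠ 0`, and then `g = φ p / φ q`. -/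
def SpecializesTo {A B : Type} [CommRing A] [IsDomain A] [CommRing B] [IsDomain B]
    (φ : A →+* B) (f : FractionRing A) (g : FractionRing B) : Prop :=
  ∃ p q : A, φ q ≠ 0 ∧
    f = algebraMap A (FractionRing A) p / algebraMap A (FractionRing A) q ∧
    g = algebraMap B (FractionRing B) (φ p) / algebraMap B (FractionRing B) (φ q)

/-- The result of a substitution does not depend on the chosen fraction. -/
theorem SpecializesTo.unique {A B : Type} [CommRing A] [IsDomain A] [CommRing B] [IsDomain B]
    {φ : A →+* B} {f : FractionRing A} {g g' : FractionRing B}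
    (h : SpecializesTo φ f g) (h' : SpecializesTo φ f g') : g = g' := by
  obtain ⟨p, q, hq, hf, rfl⟩ := h
  obtain ⟨p', q', hq', hf', rfl⟩ := h'
  have inj : ∀ {R : Type} [CommRing R] [IsDomain R] {a : R}, a ≠ 0 →
      algebraMap R (FractionRing R) a ≠ 0 := fun {R} _ _ {a} ha =>
    (map_ne_zero_iff _ (IsFractionRing.injective R (FractionRing R))).mpr ha
  have q0 : q ≠ 0 := fun h => hq (by rw [h, map_zero])
  have q0' : q' ≠ 0 := fun h => hq' (by rw [h, map_zero])
  rw [hf, div_eq_div_iff (inj q0) (inj q0'), ← map_mul, ← map_mul] at hf'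
  have e := congrArg φ (IsFractionRing.injective A (FractionRing A) hf')
  rw [map_mul, map_mul] at e
  rw [div_eq_div_iff (inj hq) (inj hq'), ← map_mul (algebraMap B (FractionRing B)),
    ← map_mul (algebraMap B (FractionRing B)), e]

/-- The nonempty subsets `T ⊆ [n]`. -/
abbrev NonemptySubset (n : ℕ) : Type := {T : Finset (Fin n) // T.Nonempty}

/-- The nonempty subsets `T ⊊ [n]`. -/
abbrev ProperSubset (n : ℕ) : Type := {T : NonemptySubset n // T.1 ≠ Finset.univ}

/-- `Δ_T = conv (e_i | i ∈ T)`. -/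
def simplexOf {n : ℕ} (T : NonemptySubset n) : Set (Fin n → ℝ) :=
  convexHull ℝ ((fun i => (Pi.single i 1 : Fin n → ℝ)) '' (T.1 : Set (Fin n)))

/-- The cone `Cone(P)*` for the Minkowski sum `P = ∑_T Δ_T`. -/
def permutohedronDualCone (n : ℕ) : Set (Fin n → ℝ) :=
  dualCone (coneOver (∑ T : NonemptySubset n, simplexOf T))

/-- The substitution `z = 0`, `x_{[n]} = - ∑_{T ≠ [n]} x_T`, with all other `x_T` unchanged. -/
def restrictToSumZero (n : ℕ) :
    MvPolynomial (NonemptySubset n ⊕ Fin n) ℝ →ₐ[ℝ] MvPolynomial (ProperSubset n) ℝ :=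
  MvPolynomial.aeval (Sum.elim
    (fun T => if h : T.1 ≠ Finset.univ then MvPolynomial.X ⟨T, h⟩
      else -∑ U : ProperSubset n, MvPolynomial.X U)
    (fun _ => 0))

/-- `σ[1:a] = {σ(1), …, σ(a)}`. -/
def prefixSet {n : ℕ} (σ : Equiv.Perm (Fin n)) (a : ℕ) : Finset (Fin n) :=
  (Finset.univ.filter fun i : Fin n => (i : ℕ) < a).image σ

/-- The linear form `∑_{∅ ≠ T ⊆ A} x_T`, for `A ⊊ [n]`. -/
def subsetSum {n : ℕ} (A : Finset (Fin n)) : MvPolynomial (ProperSubset n) ℝ :=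
  ∑ T ∈ Finset.univ.filter (fun T : ProperSubset n => T.1.1 ⊆ A), MvPolynomial.X T

end

/-! The minimum of `⟨v, ·⟩` over a Minkowski sum is the sum of the minima, so the dual cone is
`{minSum ≥ 0}` and its boundary is `{minSum = 0}`. Here `minSum` is linear exactly on the chambers
of the braid fan, because the two-element sets `T` already detect the order of the coordinates
(`vertexForm_eq_minSum_iff`). Adding `c • 𝟏` changes `minSum` by a nonzero multiple of `c`, so each
line parallel to `𝟏` meets the boundary exactly once. The boundary is therefore a copy of the braid
fan modulo `𝟏`: its facets are indexed by permutations, and `facet σ` is spanned by the indicator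
vectors of the proper nonempty prefixes of `σ`, shifted along `𝟏` (`spanCone_flagRay`).

These facets are already simplicial. Hence every triangulation that uses only extreme rays consists
of exactly these facets (`exists_flagRay_of_spanCone_subset_frontier`), up to the order and scale of
the generators. Neither affects a summand, and the determinant for the standard generators is `±1`
(`hyperplaneDualMixedVolume_eq`).

The minimum of `ray B` over `Δ_T` is `[T ⊆ B]` plus a shift independent of `T`. On `z = 0`, `∑ x_T =
0` the shift cancels, and the denominator factor becomes `-∑_{T ⊆ B} x_T`
(`restrictToSumZero_mixedSupportForm_ray`). This is nonzero, so the substitution is valid term by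
term, and the `n - 1` signs give `(-1)^(n-1)`. -/

noncomputable section

variable {n m : ℕ}

/-! ### The support function of the generalized permutohedron `∑ T, Δ_T` -/

/-- The minimum of `⟨v, ·⟩` over `Δ_T`. -/
def simplexMin (T : NonemptySubset n) (v : Fin n → ℝ) : ℝ := T.1.inf' T.2 v

/-- The minimum of `⟨v, ·⟩` over `∑ T, Δ_T`. -/
def minSum (v : Fin n → ℝ) : ℝ := ∑ T : NonemptySubset n, simplexMin T v

lemma simplexMin_le (T : NonemptySubset n) (v : Fin n → ℝ) {i : Fin n} (hi : i ∈ T.1) :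
    simplexMin T v ≤ v i := Finset.inf'_le _ hi

lemma le_simplexMin {T : NonemptySubset n} {v : Fin n → ℝ} {c : ℝ} (h : ∀ i ∈ T.1, c ≤ v i) :
    c ≤ simplexMin T v := Finset.le_inf' _ _ h

lemma exists_simplexMin (T : NonemptySubset n) (v : Fin n → ℝ) : ∃ i ∈ T.1, simplexMin T v = v i :=
  Finset.exists_mem_eq_inf' _ _

lemma simplexMin_eq {T : NonemptySubset n} {v : Fin n → ℝ} {i : Fin n} (hi : i ∈ T.1)
    (h : ∀ j ∈ T.1, v i ≤ v j) : simplexMin T v = v i :=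
  le_antisymm (simplexMin_le T v hi) (le_simplexMin h)

lemma simplexMin_add_const (T : NonemptySubset n) (v : Fin n → ℝ) (c : ℝ) :
    simplexMin T (fun i => v i + c) = simplexMin T v + c := by
  obtain ⟨i, hi, h⟩ := exists_simplexMin T v
  rw [h]
  exact simplexMin_eq hi fun j hj => by simpa using h ▸ simplexMin_le T v hj

lemma minSum_add_const (v : Fin n → ℝ) (c : ℝ) :
    minSum (fun i => v i + c) = minSum v + Fintype.card (NonemptySubset n) * c := by
  simp [minSum, simplexMin_add_const, Finset.sum_add_distrib]

lemma card_nonemptySubset_pos (hn : 0 < n) : (0 : ℝ) < Fintype.card (NonemptySubset n) := by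
  have : Nonempty (NonemptySubset n) := ⟨⟨{⟨0, hn⟩}, Finset.singleton_nonempty _⟩⟩
  exact_mod_cast Fintype.card_pos

lemma continuous_minSum : Continuous (minSum : (Fin n → ℝ) → ℝ) := by
  refine continuous_finsetSum _ fun T _ => ?_
  have := Continuous.finset_inf' (f := fun i (v : Fin n → ℝ) => v i) T.2
    fun i _ => continuous_apply i
  convert this using 1
  ext v
  simp [simplexMin, Finset.inf'_apply]

lemma simplexMin_le_dotProduct {T : NonemptySubset n} (v : Fin n → ℝ) {y : Fin n → ℝ}
    (hy : y ∈ simplexOf T) : simplexMin T v ≤ v ⬝ᵥ y := by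
  have hc : Convex ℝ {y : Fin n → ℝ | simplexMin T v ≤ v ⬝ᵥ y} :=
    convex_halfSpace_ge (f := fun y => v ⬝ᵥ y)
      ⟨fun x y => dotProduct_add v x y, fun c x => dotProduct_smul c v x⟩ _
  refine convexHull_min ?_ hc hy
  rintro _ ⟨i, hi, rfl⟩
  simpa using simplexMin_le T v hi

lemma single_mem_simplexOf {T : NonemptySubset n} {i : Fin n} (hi : i ∈ T.1) :
    (Pi.single i 1 : Fin n → ℝ) ∈ simplexOf T :=
  subset_convexHull _ _ ⟨i, hi, rfl⟩

lemma supportFn_simplexOf (T : NonemptySubset n) (v : Fin n → ℝ) :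
    supportFn (simplexOf T) v = -simplexMin T v := by
  have : IsLeast ((fun y => v ⬝ᵥ y) '' simplexOf T) (simplexMin T v) := by
    constructor
    · obtain ⟨i, hi, h⟩ := exists_simplexMin T v
      exact ⟨_, single_mem_simplexOf hi, by simp [h]⟩
    · rintro _ ⟨y, hy, rfl⟩
      exact simplexMin_le_dotProduct v hy
  rw [supportFn, this.csInf_eq]

lemma mem_permutohedronDualCone {v : Fin n → ℝ} :
    v ∈ permutohedronDualCone n ↔ 0 ≤ minSum v := by
  constructor
  · intro h
    choose f hf hf' using fun T : NonemptySubset n => exists_simplexMin T v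
    have := h (∑ T, Pi.single (f T) 1) ⟨1, zero_le_one, _, Set.mem_finsetSum _ _ _ |>.2
      ⟨fun T => Pi.single (f T) 1, fun {T} _ => single_mem_simplexOf (hf T), rfl⟩,
      (one_smul _ _).symm⟩
    simpa [dotProduct_sum, minSum, hf'] using this
  · rintro h _ ⟨t, ht, y, hy, rfl⟩
    obtain ⟨w, hw, rfl⟩ := (Set.mem_finsetSum _ _ _).1 hy
    rw [dotProduct_smul, dotProduct_sum]
    exact mul_nonneg ht (h.trans (Finset.sum_le_sum fun T hT => simplexMin_le_dotProduct v (hw hT)))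

lemma frontier_permutohedronDualCone (hn : 0 < n) :
    frontier (permutohedronDualCone n) = {v | minSum v = 0} := by
  have hC : permutohedronDualCone n = {v | 0 ≤ minSum v} :=
    Set.ext fun v => mem_permutohedronDualCone
  apply subset_antisymm
  · rw [hC]
    exact (frontier_le_subset_eq continuous_const continuous_minSum).trans fun v h => Eq.symm h
  · intro v (hv : minSum v = 0)
    rw [frontier_eq_closure_inter_closure, hC]
    -- Moving from `v` by a small negative multiple of `𝟏` leaves the cone.
    refine ⟨subset_closure hv.ge, mem_closure_iff_seq_limit.2
      ⟨fun k i => v i + -(1 / ((k : ℝ) + 1)), fun k => ?_, ?_⟩⟩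
    · rw [Set.mem_compl_iff, Set.mem_ofPred, minSum_add_const, hv, not_le, zero_add]
      exact mul_neg_of_pos_of_neg (card_nonemptySubset_pos hn) (neg_neg_of_pos (by positivity))
    · refine tendsto_pi_nhds.2 fun i => ?_
      simpa using (tendsto_const_nhds (x := v i)).add
        (tendsto_one_div_add_atTop_nhds_zero_nat (𝕜 := ℝ)).neg

/-! ### Vertices and facets -/

/-- The element of `T` that comes last in the order `σ 0, σ 1, …`. -/
def lastElt (σ : Equiv.Perm (Fin n)) (T : NonemptySubset n) : Fin n :=
  σ ((T.1.image σ.symm).max' (T.2.image _))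

lemma lastElt_mem (σ : Equiv.Perm (Fin n)) (T : NonemptySubset n) : lastElt σ T ∈ T.1 := by
  obtain ⟨i, hi, h⟩ := Finset.mem_image.1 (Finset.max'_mem (T.1.image σ.symm) (T.2.image _))
  rwa [lastElt, ← h, σ.apply_symm_apply]

lemma symm_le_symm_lastElt (σ : Equiv.Perm (Fin n)) (T : NonemptySubset n) {i : Fin n}
    (hi : i ∈ T.1) : σ.symm i ≤ σ.symm (lastElt σ T) := by
  rw [lastElt, σ.symm_apply_apply]
  exact Finset.le_max' _ _ (Finset.mem_image_of_mem _ hi)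

/-- The linear form `⟨·, y_σ⟩`, where `y_σ` is the vertex of `∑ T, Δ_T` indexed by `σ`. -/
def vertexForm (σ : Equiv.Perm (Fin n)) : StrongDual ℝ (Fin n → ℝ) :=
  ∑ T : NonemptySubset n, ContinuousLinearMap.proj (lastElt σ T)

lemma vertexForm_apply (σ : Equiv.Perm (Fin n)) (v : Fin n → ℝ) :
    vertexForm σ v = ∑ T : NonemptySubset n, v (lastElt σ T) := by
  simp [vertexForm, sum_apply]

lemma minSum_le_vertexForm (σ : Equiv.Perm (Fin n)) (v : Fin n → ℝ) :
    minSum v ≤ vertexForm σ v := by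
  rw [vertexForm_apply]
  exact Finset.sum_le_sum fun T _ => simplexMin_le T v (lastElt_mem σ T)

/-- The two sums compare term by term, so equality means that `v` attains its minimum over every `T`
at `lastElt σ T`. The pairs `T = {σ a, σ b}` suffice to force the order. -/
lemma vertexForm_eq_minSum_iff {σ : Equiv.Perm (Fin n)} {v : Fin n → ℝ} :
    vertexForm σ v = minSum v ↔ Antitone (v ∘ σ) := by
  rw [vertexForm_apply, eq_comm, minSum,
    Finset.sum_eq_sum_iff_of_le fun T _ => simplexMin_le T v (lastElt_mem σ T)]
  constructor
  · intro h a b hab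
    let T : NonemptySubset n := ⟨{σ a, σ b}, by simp⟩
    have hb : lastElt σ T = σ b := by
      have h1 := symm_le_symm_lastElt σ T (i := σ b) (by simp [T])
      have h2 := lastElt_mem σ T
      simp only [T, Finset.mem_insert, Finset.mem_singleton] at h2
      rcases h2 with h2 | h2
      · rw [h2, σ.symm_apply_apply, σ.symm_apply_apply] at h1
        rw [h2, le_antisymm hab h1]
      · exact h2
    have h3 := h T (Finset.mem_univ _)
    rw [hb] at h3
    exact h3.symm.trans_le (simplexMin_le T v (by simp [T]))
  · intro h T _
    refine simplexMin_eq (lastElt_mem σ T) fun j hj => ?_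
    simpa using h (symm_le_symm_lastElt σ T hj)

/-- The facet of the dual cone that is dual to the vertex `y_σ`. -/
def facet (σ : Equiv.Perm (Fin n)) : Set (Fin n → ℝ) :=
  {v | Antitone (v ∘ σ) ∧ minSum v = 0}

lemma mem_facet_iff_vertexForm {σ : Equiv.Perm (Fin n)} {v : Fin n → ℝ} (hv : minSum v = 0) :
    v ∈ facet σ ↔ vertexForm σ v = 0 := by
  rw [facet, Set.mem_ofPred, ← vertexForm_eq_minSum_iff, hv, and_iff_left rfl]

lemma exists_mem_facet {v : Fin n → ℝ} (hv : minSum v = 0) : ∃ σ, v ∈ facet σ := by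
  refine ⟨Tuple.sort (fun i => -v i), fun a b hab => ?_, hv⟩
  simpa using Tuple.monotone_sort (fun i => -v i) hab

/-- An interior point of a chamber lies in no other chamber: `σ.symm ∘ τ` is a strictly monotone
bijection of `Fin n`, hence the identity. -/
lemma eq_of_strictAnti_comp_of_antitone_comp {σ τ : Equiv.Perm (Fin n)} {v : Fin n → ℝ}
    (hσ : StrictAnti (v ∘ σ)) (hτ : Antitone (v ∘ τ)) : σ = τ := by
  have hm : StrictMono (σ.symm ∘ τ) := by
    refine Monotone.strictMono_of_injective (fun a b hab => ?_)
      (σ.symm.injective.comp τ.injective)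
    rw [← hσ.le_iff_ge]
    simpa using hτ hab
  have e : Set.range (σ.symm ∘ τ) = Set.range (id : Fin n → Fin n) := by
    rw [Set.range_id, Function.Surjective.range_eq (σ.symm.surjective.comp τ.surjective)]
  ext j
  have := congrFun ((StrictMono.range_inj hm strictMono_id).1 e) j
  simp only [Function.comp_apply, id_eq, Equiv.symm_apply_eq] at this
  rw [this]

lemma exists_strictAnti_mem_facet (hn : 0 < n) (σ : Equiv.Perm (Fin n)) :
    ∃ v : Fin n → ℝ, StrictAnti (v ∘ σ) ∧ v ∈ facet σ := by
  let q : Fin n → ℝ := fun j => -((σ.symm j : ℕ) : ℝ)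
  let c := -(minSum q / Fintype.card (NonemptySubset n))
  have ha : StrictAnti ((fun j => q j + c) ∘ σ) := by
    intro a b hab
    have : ((a : ℕ) : ℝ) < (b : ℕ) := by exact_mod_cast hab
    simp only [Function.comp_apply, q, σ.symm_apply_apply]
    linarith
  refine ⟨_, ha, ha.antitone, ?_⟩
  rw [minSum_add_const, mul_neg, mul_div_cancel₀ _ (card_nonemptySubset_pos hn).ne',
    add_neg_cancel]

lemma facet_injective (hn : 0 < n) : Function.Injective (facet (n := n)) := by
  intro σ τ h
  obtain ⟨v, hv, hvσ⟩ := exists_strictAnti_mem_facet hn σ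
  rw [h] at hvσ
  exact eq_of_strictAnti_comp_of_antitone_comp hv hvσ.1

/-! ### Rays -/

/-- The multiple of `𝟏` that moves the indicator vector of `B` to the boundary. -/
def rayShift (B : Finset (Fin n)) : ℝ :=
  -(minSum (fun i => if i ∈ B then (1 : ℝ) else 0) / Fintype.card (NonemptySubset n))

/-- The generator of an extreme ray of the dual cone that corresponds to `B`. -/
def ray (B : Finset (Fin n)) : Fin n → ℝ := fun i => (if i ∈ B then 1 else 0) + rayShift B

lemma minSum_ray (hn : 0 < n) (B : Finset (Fin n)) : minSum (ray B) = 0 := by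
  unfold ray
  rw [minSum_add_const, rayShift, mul_neg, mul_div_cancel₀ _ (card_nonemptySubset_pos hn).ne',
    add_neg_cancel]

lemma simplexMin_ray (T : NonemptySubset n) (B : Finset (Fin n)) :
    simplexMin T (ray B) = (if T.1 ⊆ B then 1 else 0) + rayShift B := by
  unfold ray
  rw [simplexMin_add_const]
  congr 1
  split_ifs with h
  · obtain ⟨i, hi⟩ := T.2
    rw [simplexMin_eq hi fun j hj => by simp [h hj, h hi], if_pos (h hi)]
  · obtain ⟨i, hi, hiB⟩ := Finset.not_subset.1 h
    rw [simplexMin_eq hi fun j hj => by simp only [hiB, if_false]; split_ifs <;> norm_num,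
      if_neg hiB]

lemma apply_mem_prefixSet {σ : Equiv.Perm (Fin n)} {k : Fin n} {a : ℕ} :
    σ k ∈ prefixSet σ a ↔ (k : ℕ) < a := by
  simp [prefixSet]

lemma ray_prefixSet_mem_facet (hn : 0 < n) (σ : Equiv.Perm (Fin n)) (a : ℕ) :
    ray (prefixSet σ a) ∈ facet σ := by
  refine ⟨fun i j hij => ?_, minSum_ray hn _⟩
  simp only [Function.comp_apply, ray, apply_mem_prefixSet, add_le_add_iff_right]
  have : (i : ℕ) ≤ j := hij
  split_ifs <;> first | exact le_rfl | exact zero_le_one | omega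

/-- The generators of the rays of `facet σ`. -/
def flagRay (σ : Equiv.Perm (Fin (m + 1))) (i : Fin m) : Fin (m + 1) → ℝ :=
  ray (prefixSet σ (i + 1))

lemma flagRay_mem_facet (σ : Equiv.Perm (Fin (m + 1))) (i : Fin m) : flagRay σ i ∈ facet σ :=
  ray_prefixSet_mem_facet m.succ_pos σ _

/-- Abel summation along the order `σ`: the coefficients are the consecutive drops of `v`, and the
shifts of the rays are absorbed into `c`. -/
lemma exists_eq_sum_flagRay_add_const (σ : Equiv.Perm (Fin (m + 1))) (v : Fin (m + 1) → ℝ) :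
    ∃ c : ℝ, v = fun j =>
      (∑ i : Fin m, (v (σ i.castSucc) - v (σ i.succ)) • flagRay σ i) j + c := by
  refine ⟨v (σ (Fin.last m)) - ∑ i : Fin m, (v (σ i.castSucc) - v (σ i.succ)) *
    rayShift (prefixSet σ (i + 1)), ?_⟩
  -- Telescoping: the condition `k < i + 1` keeps the drops from position `k` onwards.
  have key : ∀ k : Fin (m + 1), v (σ k) = (∑ i : Fin m, (v (σ i.castSucc) - v (σ i.succ)) *
      (if (k : ℕ) < i + 1 then 1 else 0)) + v (σ (Fin.last m)) := by
    intro k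
    induction k using Fin.reverseInduction with
    | last =>
      rw [Finset.sum_eq_zero, zero_add]
      intro i _
      rw [if_neg (by simp), mul_zero]
    | cast k ih =>
      have hs : ∀ i : Fin m, (if (k.castSucc : ℕ) < i + 1 then (1 : ℝ) else 0) =
          (if i = k then 1 else 0) + if (k.succ : ℕ) < i + 1 then 1 else 0 := by
        intro i
        simp only [Fin.val_castSucc, Fin.val_succ, Fin.ext_iff]
        split_ifs <;> first | omega | norm_num
      simp only [hs, mul_add, Finset.sum_add_distrib, mul_ite, mul_one, mul_zero,
        Finset.sum_ite_eq', Finset.mem_univ, if_true]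
      simp only [mul_ite, mul_one, mul_zero] at ih
      rw [add_assoc, ← ih]
      ring
  ext j
  obtain ⟨k, rfl⟩ := σ.surjective j
  conv_lhs => rw [key k]
  simp only [Finset.sum_apply, Pi.smul_apply, smul_eq_mul, flagRay, ray, apply_mem_prefixSet,
    mul_add, Finset.sum_add_distrib]
  ring

/-- `vertexForm σ` vanishes on `v` and on every `flagRay σ i` but not on `𝟏`, so the constant left
over from the Abel summation is zero. -/
lemma eq_sum_flagRay_of_mem_facet {σ : Equiv.Perm (Fin (m + 1))} {v : Fin (m + 1) → ℝ}
    (hv : v ∈ facet σ) :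
    v = ∑ i : Fin m, (v (σ i.castSucc) - v (σ i.succ)) • flagRay σ i := by
  obtain ⟨c, hc⟩ := exists_eq_sum_flagRay_add_const σ v
  set u := ∑ i : Fin m, (v (σ i.castSucc) - v (σ i.succ)) • flagRay σ i
  have hu : vertexForm σ u = 0 := by
    rw [map_sum]
    refine Finset.sum_eq_zero fun i _ => ?_
    rw [map_smul, (mem_facet_iff_vertexForm (flagRay_mem_facet σ i).2).1 (flagRay_mem_facet σ i),
      smul_zero]
  have h0 := (mem_facet_iff_vertexForm hv.2).1 hv
  have h1 : vertexForm σ v = vertexForm σ u + Fintype.card (NonemptySubset (m + 1)) * c := by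
    conv_lhs => rw [hc]
    simp [vertexForm_apply, Finset.sum_add_distrib]
  rw [h0, hu, zero_add, eq_comm, mul_eq_zero,
    or_iff_right (card_nonemptySubset_pos m.succ_pos).ne'] at h1
  rw [hc, h1]
  ext j
  simp

lemma mem_spanCone {d k : ℕ} {F : Fin k → Fin d → ℝ} {v : Fin d → ℝ} :
    v ∈ spanCone F ↔ ∃ c : Fin k → ℝ, (∀ i, 0 ≤ c i) ∧ v = ∑ i, c i • F i := by
  rw [spanCone, SetLike.mem_coe, PointedCone.hull, Submodule.mem_span_range_iff_exists_fun]
  constructor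
  · rintro ⟨c, rfl⟩
    exact ⟨fun i => c i, fun i => (c i).2, rfl⟩
  · rintro ⟨c, hc, rfl⟩
    exact ⟨fun i => ⟨c i, hc i⟩, rfl⟩

lemma mem_spanCone_self {d k : ℕ} (F : Fin k → Fin d → ℝ) (i : Fin k) : F i ∈ spanCone F :=
  Submodule.subset_span ⟨i, rfl⟩

lemma sum_smul_mem_facet {ι : Type*} [Fintype ι] {σ : Equiv.Perm (Fin n)}
    {c : ι → ℝ} {F : ι → Fin n → ℝ} (hc : ∀ i, 0 ≤ c i) (hF : ∀ i, F i ∈ facet σ) :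
    ∑ i, c i • F i ∈ facet σ := by
  have ha : Antitone ((∑ i, c i • F i) ∘ σ) := by
    intro a b hab
    simp only [Function.comp_apply, Finset.sum_apply, Pi.smul_apply, smul_eq_mul]
    exact Finset.sum_le_sum fun i _ => mul_le_mul_of_nonneg_left ((hF i).1 hab) (hc i)
  refine ⟨ha, ?_⟩
  rw [← vertexForm_eq_minSum_iff.2 ha, map_sum]
  refine Finset.sum_eq_zero fun i _ => ?_
  rw [map_smul, (mem_facet_iff_vertexForm (hF i).2).1 (hF i), smul_zero]

lemma spanCone_flagRay (σ : Equiv.Perm (Fin (m + 1))) : spanCone (flagRay σ) = facet σ := by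
  ext v
  rw [mem_spanCone]
  constructor
  · rintro ⟨c, hc, rfl⟩
    exact sum_smul_mem_facet hc (flagRay_mem_facet σ)
  · intro hv
    exact ⟨_, fun i => sub_nonneg.2 (hv.1 i.castSucc_lt_succ.le), eq_sum_flagRay_of_mem_facet hv⟩

/-- Rescaling and reordering generators does not change a simplicial cone. -/
lemma spanCone_eq_of_smul_perm {d k : ℕ} {F G : Fin k → Fin d → ℝ} {t : Fin k → ℝ}
    (π : Equiv.Perm (Fin k)) (ht : ∀ i, 0 < t i) (h : ∀ i, F i = t i • G (π i)) :
    spanCone F = spanCone G := by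
  apply subset_antisymm
  · refine Submodule.span_le.2 ?_
    rintro _ ⟨i, rfl⟩
    rw [h]
    exact Submodule.smul_mem (PointedCone.hull ℝ (Set.range G)) ⟨t i, (ht i).le⟩
      (mem_spanCone_self G (π i))
  · refine Submodule.span_le.2 ?_
    rintro _ ⟨j, rfl⟩
    have : G j = (t (π.symm j))⁻¹ • F (π.symm j) := by
      rw [h, π.apply_symm_apply, smul_smul, inv_mul_cancel₀ (ht _).ne', one_smul]
    rw [this]
    exact Submodule.smul_mem (PointedCone.hull ℝ (Set.range F)) ⟨_, (inv_pos.2 (ht _)).le⟩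
      (mem_spanCone_self F _)

/-! ### Determinants -/

lemma rowsWithOne_castSucc (F : Fin m → Fin (m + 1) → ℝ) (i : Fin m) :
    rowsWithOne (d := m + 1) F i.castSucc = F i := by
  ext j
  simp [rowsWithOne]

lemma rowsWithOne_last (F : Fin m → Fin (m + 1) → ℝ) :
    rowsWithOne (d := m + 1) F (Fin.last m) = 1 := by
  ext j
  simp [rowsWithOne]

lemma abs_det_rowsWithOne_smul_perm {F G : Fin m → Fin (m + 1) → ℝ} {t : Fin m → ℝ}
    (π : Equiv.Perm (Fin m)) (ht : ∀ i, 0 < t i) (h : ∀ i, F i = t i • G (π i)) :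
    |(rowsWithOne (d := m + 1) F).det| = (∏ i, t i) * |(rowsWithOne (d := m + 1) G).det| := by
  let s : Fin (m + 1) → ℝ := Fin.snoc (α := fun _ => ℝ) t 1
  let e : Fin (m + 1) ≃ Fin m ⊕ Unit := finSumFinEquiv.symm.trans (Equiv.sumCongr (.refl _)
    -- The row permutation `ρ` built from `e` extends `π` and fixes the last row `𝟏`, whose scaling
    -- factor in `s` is `1`.
    (Equiv.ofUnique (Fin 1) Unit))
  let ρ : Equiv.Perm (Fin (m + 1)) := e.trans ((Equiv.sumCongr π (.refl _)).trans e.symm)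
  have hρ : ∀ i : Fin m, ρ i.castSucc = (π i).castSucc := by
    intro i
    have : e i.castSucc = Sum.inl i := by
      simp only [e, Equiv.trans_apply]
      erw [finSumFinEquiv_symm_apply_castAdd]
      rfl
    simp only [ρ, Equiv.trans_apply, this]
    rfl
  have hρ' : ρ (Fin.last m) = Fin.last m := by
    have h1 : ρ (Fin.last m) ∉ Set.range Fin.castSucc := by
      rintro ⟨i, hi⟩
      rw [← π.apply_symm_apply i, ← hρ] at hi
      exact (Fin.castSucc_lt_last _).ne (ρ.injective hi)
    by_contra h2
    exact h1 ⟨_, Fin.castSucc_castPred _ h2⟩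
  have hM : rowsWithOne (d := m + 1) F =
      Matrix.of fun i j => s i * (rowsWithOne (d := m + 1) G).submatrix ρ id i j := by
    ext i j
    induction i using Fin.lastCases with
    | last =>
      simp only [Matrix.of_apply, Matrix.submatrix_apply, hρ', rowsWithOne_last]
      simp [s]
    | cast i =>
      simp only [Matrix.of_apply, Matrix.submatrix_apply, hρ, rowsWithOne_castSucc, h]
      simp [s]
  rw [hM, Matrix.det_mul_column, Matrix.det_permute, abs_mul, abs_mul, Fin.prod_univ_castSucc]
  have h1 : |((Equiv.Perm.sign ρ : ℤ) : ℝ)| = 1 := by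
    rcases Int.units_eq_one_or (Equiv.Perm.sign ρ) with h | h <;> simp [h]
  rw [h1, one_mul]
  simp only [s, Fin.snoc_castSucc, Fin.snoc_last, mul_one]
  rw [abs_of_pos (Finset.prod_pos fun i _ => ht i)]

/-- Subtracting multiples of the row `𝟏` removes the shifts. With the columns ordered by `σ`, the
prefix indicators then form a unitriangular matrix. -/
lemma abs_det_rowsWithOne_flagRay (σ : Equiv.Perm (Fin (m + 1))) :
    |(rowsWithOne (d := m + 1) (flagRay σ)).det| = 1 := by
  let B : Matrix (Fin (m + 1)) (Fin (m + 1)) ℝ :=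
    Matrix.of fun i j => if j ≤ i then 1 else 0
  have hB : B.det = 1 := by
    rw [Matrix.det_of_isLowerTriangular]
    · simp [B]
    · intro i j hij
      have : i < j := hij
      simp [B, this]
  have h : ((rowsWithOne (d := m + 1) (flagRay σ)).submatrix id σ).det = B.det := by
    refine Matrix.det_eq_of_forall_row_eq_smul_add_const
      (Fin.snoc (α := fun _ => ℝ) (fun i : Fin m => rayShift (prefixSet σ (i + 1))) 0)
      (Fin.last m) (by simp) fun i j => ?_
    have hlast : rowsWithOne (d := m + 1) (flagRay σ) (Fin.last m) (σ j) = 1 :=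
      congrFun (rowsWithOne_last (flagRay σ)) (σ j)
    have hBl : B (Fin.last m) j = 1 := if_pos (Fin.le_last j)
    induction i using Fin.lastCases with
    | last =>
      rw [Matrix.submatrix_apply, id, hlast, hBl, Fin.snoc_last, zero_mul, add_zero]
    | cast i =>
      have hi : rowsWithOne (d := m + 1) (flagRay σ) i.castSucc (σ j) = flagRay σ i (σ j) :=
        congrFun (rowsWithOne_castSucc (flagRay σ) i) (σ j)
      have hBi : B i.castSucc j = if (j : ℕ) < i + 1 then 1 else 0 :=
        if_congr (by rw [Fin.le_def, Nat.lt_succ_iff]; rfl) rfl rfl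
      rw [Matrix.submatrix_apply, id, hi, hBi, hBl, Fin.snoc_castSucc, mul_one, flagRay, ray]
      simp only [apply_mem_prefixSet]
  rw [Matrix.det_permute', hB] at h
  have h1 := congrArg abs h
  rw [abs_mul, abs_one] at h1
  have h2 : |((Equiv.Perm.sign σ : ℤ) : ℝ)| = 1 := by
    rcases Int.units_eq_one_or (Equiv.Perm.sign σ) with h | h <;> simp [h]
  rwa [h2, one_mul] at h1

lemma linearIndependent_flagRay (σ : Equiv.Perm (Fin (m + 1))) :
    LinearIndependent ℝ (flagRay σ) := by
  have h := Matrix.linearIndependent_rows_of_det_ne_zero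
    (A := rowsWithOne (d := m + 1) (flagRay σ)) fun h => by
      simpa [h] using abs_det_rowsWithOne_flagRay σ
  have h' := h.comp Fin.castSucc (Fin.castSucc_injective m)
  have e : (fun i => rowsWithOne (d := m + 1) (flagRay σ) i) ∘ Fin.castSucc = flagRay σ :=
    funext fun i => rowsWithOne_castSucc _ i
  rwa [e] at h'

lemma flagRay_ne_zero (σ : Equiv.Perm (Fin (m + 1))) (i : Fin m) : flagRay σ i ≠ 0 :=
  (linearIndependent_flagRay σ).ne_zero i

/-! ### Extreme rays and existence of the triangulation -/

lemma minSum_smul {t : ℝ} (ht : 0 ≤ t) (v : Fin n → ℝ) : minSum (t • v) = t * minSum v := by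
  rw [minSum, minSum, Finset.mul_sum]
  refine Finset.sum_congr rfl fun T _ => ?_
  obtain ⟨i, hi, h⟩ := exists_simplexMin T v
  rw [h]
  exact simplexMin_eq hi fun j hj =>
    mul_le_mul_of_nonneg_left (h ▸ simplexMin_le T v hj) ht

lemma ray_ne_zero (B : Finset (Fin n)) (h : B.Nonempty) (h' : B ≠ Finset.univ) : ray B ≠ 0 := by
  obtain ⟨i, hi⟩ := h
  obtain ⟨j, hj⟩ : ∃ j, j ∉ B := by simpa [Finset.eq_univ_iff_forall] using h'
  intro h0
  have h1 := congrFun h0 i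
  have h2 := congrFun h0 j
  simp only [ray, hi, hj, if_true, if_false, Pi.zero_apply] at h1 h2
  linarith

/-- The part of `T` outside `B`, or `T` itself if there is none: the face of `Δ_T` on which
`ray B` is minimal. -/
def minFace (B : Finset (Fin n)) (T : NonemptySubset n) : NonemptySubset n :=
  if h : (T.1 \ B).Nonempty then ⟨T.1 \ B, h⟩ else T

lemma minFace_subset (B : Finset (Fin n)) (T : NonemptySubset n) :
    (minFace B T).1 ⊆ T.1 := by
  unfold minFace
  split_ifs
  · exact Finset.sdiff_subset
  · exact subset_rfl

lemma ray_eq_simplexMin_of_mem_minFace {B : Finset (Fin n)} {T : NonemptySubset n} {i : Fin n}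
    (hi : i ∈ (minFace B T).1) : ray B i = simplexMin T (ray B) := by
  rw [simplexMin_ray, ray]
  congr 1
  unfold minFace at hi
  refine if_congr ?_ rfl rfl
  split_ifs at hi with h
  · have h1 := (Finset.mem_sdiff.1 hi).2
    exact ⟨fun h2 => absurd h2 h1, fun h2 => absurd (h2 (Finset.mem_sdiff.1 hi).1) h1⟩
  · have : T.1 ⊆ B := Finset.sdiff_eq_empty_iff_subset.1 (Finset.not_nonempty_iff_eq_empty.1 h)
    exact ⟨fun _ => this, fun _ => this hi⟩

/-- The inner product with the point `∑ T, y_T`, where `y_T` is the barycenter of the face of `Δ_T`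
on which `ray B` is minimal. -/
def barycenterForm (B : Finset (Fin n)) : StrongDual ℝ (Fin n → ℝ) :=
  ∑ T : NonemptySubset n, ((minFace B T).1.card : ℝ)⁻¹ •
    ∑ i ∈ (minFace B T).1, ContinuousLinearMap.proj i

lemma barycenterForm_apply (B : Finset (Fin n)) (v : Fin n → ℝ) :
    barycenterForm B v = ∑ T : NonemptySubset n, ((minFace B T).1.card : ℝ)⁻¹ *
      ∑ i ∈ (minFace B T).1, v i := by
  simp [barycenterForm]

lemma card_minFace_pos (B : Finset (Fin n)) (T : NonemptySubset n) :
    (0 : ℝ) < (minFace B T).1.card := by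
  exact_mod_cast (minFace B T).2.card_pos

lemma simplexMin_le_average (B : Finset (Fin n)) (T : NonemptySubset n) (v : Fin n → ℝ) :
    simplexMin T v ≤ ((minFace B T).1.card : ℝ)⁻¹ * ∑ i ∈ (minFace B T).1, v i := by
  rw [le_inv_mul_iff₀ (card_minFace_pos B T), ← nsmul_eq_mul, ← Finset.sum_const]
  exact Finset.sum_le_sum fun i hi => simplexMin_le T v (minFace_subset B T hi)

lemma minSum_le_barycenterForm (B : Finset (Fin n)) (v : Fin n → ℝ) :
    minSum v ≤ barycenterForm B v := by
  rw [barycenterForm_apply]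
  exact Finset.sum_le_sum fun T _ => simplexMin_le_average B T v

lemma barycenterForm_ray (hn : 0 < n) (B : Finset (Fin n)) : barycenterForm B (ray B) = 0 := by
  rw [barycenterForm_apply, ← minSum_ray hn B]
  refine Finset.sum_congr rfl fun T _ => ?_
  rw [Finset.sum_congr rfl fun i hi => ray_eq_simplexMin_of_mem_minFace hi, Finset.sum_const,
    nsmul_eq_mul, inv_mul_cancel_left₀ (card_minFace_pos B T).ne']

lemma eq_simplexMin_of_barycenterForm_eq {B : Finset (Fin n)} {v : Fin n → ℝ}
    (h : barycenterForm B v = minSum v) (T : NonemptySubset n) {i : Fin n}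
    (hi : i ∈ (minFace B T).1) : v i = simplexMin T v := by
  rw [barycenterForm_apply, eq_comm, minSum,
    Finset.sum_eq_sum_iff_of_le fun T _ => simplexMin_le_average B T v] at h
  have h1 := h T (Finset.mem_univ _)
  rw [eq_inv_mul_iff_mul_eq₀ (card_minFace_pos B T).ne', ← nsmul_eq_mul, ← Finset.sum_const,
    Finset.sum_eq_sum_iff_of_le fun j hj => simplexMin_le T v (minFace_subset B T hj)] at h1
  exact (h1 i hi).symm

/-- The exposing functional is `-barycenterForm B`. On the dual cone `barycenterForm B` dominates
`minSum ≥ 0`, so where it vanishes `v` is minimal over `T` at every point of `minFace B T`. Pairs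
`T` then show that `v` is constant on `B` and, with a value no larger, outside `B`; `minSum v = 0`
fixes the multiple of `𝟏`. -/
lemma isExtremeRayGenerator_ray {B : Finset (Fin n)} (hB : B.Nonempty) (hB' : B ≠ Finset.univ) :
    IsExtremeRayGenerator (permutohedronDualCone n) (ray B) := by
  obtain ⟨i₀, hi₀⟩ := hB
  obtain ⟨j₀, hj₀⟩ : ∃ j, j ∉ B := by simpa [Finset.eq_univ_iff_forall] using hB'
  have hn : 0 < n := i₀.pos
  refine ⟨ray_ne_zero B ⟨i₀, hi₀⟩ hB', fun _ => ⟨-barycenterForm B, ?_⟩⟩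
  ext v
  constructor
  · rintro ⟨t, ht, rfl⟩
    refine ⟨mem_permutohedronDualCone.2 ?_, fun y hy => ?_⟩
    · rw [minSum_smul ht, minSum_ray hn, mul_zero]
    · simpa [barycenterForm_ray hn] using
        (mem_permutohedronDualCone.1 hy).trans (minSum_le_barycenterForm B y)
  · rintro ⟨hv, hmax⟩
    have h0 : barycenterForm B v ≤ 0 := by
      simpa using hmax 0 (mem_permutohedronDualCone.2 (by
        simpa using (minSum_smul le_rfl (0 : Fin n → ℝ)).ge))
    have hv := mem_permutohedronDualCone.1 hv
    have h1 := minSum_le_barycenterForm B v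
    have h2 : minSum v = 0 := by linarith
    have h3 : barycenterForm B v = minSum v := by linarith
    -- For `T = {i, j}` the face `T \ B` contains `i`.
    have hout : ∀ i ∉ B, ∀ j, v i ≤ v j := by
      intro i hi j
      have := eq_simplexMin_of_barycenterForm_eq h3 ⟨{i, j}, by simp⟩ (i := i) (by
        have : (({i, j} : Finset (Fin n)) \ B).Nonempty := ⟨i, by simp [hi]⟩
        simp [minFace, this, hi])
      rw [this]
      exact simplexMin_le _ v (by simp)
    -- Now `T = {i, j}` lies in `B`, so its minimal face is all of `T`.
    have hin : ∀ i ∈ B, ∀ j ∈ B, v i ≤ v j := by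
      intro i hi j hj
      have := eq_simplexMin_of_barycenterForm_eq h3 ⟨{i, j}, by simp⟩ (i := i) (by
        have : ({i, j} : Finset (Fin n)) \ B = ∅ := by
          rw [Finset.sdiff_eq_empty_iff_subset]
          simp [Finset.insert_subset_iff, hi, hj]
        simp [minFace, this])
      rw [this]
      exact simplexMin_le _ v (by simp)
    have ht : 0 ≤ v i₀ - v j₀ := sub_nonneg.2 (hout _ hj₀ _)
    refine ⟨v i₀ - v j₀, ht, ?_⟩
    have e : v = fun k => ((v i₀ - v j₀) • ray B) k +
        (v j₀ - (v i₀ - v j₀) * rayShift B) := by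
      ext k
      simp only [Pi.smul_apply, smul_eq_mul, ray]
      by_cases hk : k ∈ B
      · rw [if_pos hk, le_antisymm (hin k hk i₀ hi₀) (hin i₀ hi₀ k hk)]
        ring
      · rw [if_neg hk, le_antisymm (hout k hk j₀) (hout j₀ hj₀ k)]
        ring
    have h4 := h2
    rw [e, minSum_add_const, minSum_smul ht, minSum_ray hn, mul_zero, zero_add, mul_eq_zero,
      or_iff_right (card_nonemptySubset_pos hn).ne'] at h4
    rw [h4] at e
    exact e.trans (funext fun k => add_zero _)

lemma prefixSet_succ_nonempty (σ : Equiv.Perm (Fin (m + 1))) (i : Fin m) :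
    (prefixSet σ (i + 1)).Nonempty :=
  ⟨σ 0, apply_mem_prefixSet.2 (by simp)⟩

lemma prefixSet_succ_ne_univ (σ : Equiv.Perm (Fin (m + 1))) (i : Fin m) :
    prefixSet σ (i + 1) ≠ Finset.univ := by
  intro h
  have : σ (Fin.last m) ∈ prefixSet σ (i + 1) := h ▸ Finset.mem_univ _
  rw [apply_mem_prefixSet, Fin.val_last] at this
  omega

lemma ray_eq_of_sameRay {B B' : Finset (Fin n)} (hB : B.Nonempty) (hB' : B ≠ Finset.univ)
    (hC : B'.Nonempty) (hC' : B' ≠ Finset.univ) (h : SameRay ℝ (ray B) (ray B')) : B = B' := by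
  obtain ⟨r, s, hr, hs, h⟩ := h.exists_pos (ray_ne_zero B hB hB') (ray_ne_zero B' hC hC')
  obtain ⟨i₀, hi₀⟩ := hB
  obtain ⟨j₀, hj₀⟩ : ∃ j, j ∉ B := by simpa [Finset.eq_univ_iff_forall] using hB'
  -- Subtracting coordinates `j` from `i` cancels the shifts: `r > 0` equals `s` times the
  -- difference of the indicators of `B'` at `i` and `j`.
  have key : ∀ i ∈ B, ∀ j ∉ B, i ∈ B' ∧ j ∉ B' := by
    intro i hi j hj
    have h1 := congrFun h i
    have h2 := congrFun h j
    simp only [Pi.smul_apply, smul_eq_mul, ray, hi, hj, if_true, if_false] at h1 h2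
    by_cases h3 : i ∈ B' <;> by_cases h4 : j ∈ B' <;> simp only [h3, h4, if_true, if_false] at h1 h2
    · nlinarith
    · exact ⟨h3, h4⟩
    · nlinarith
    · nlinarith
  ext i
  by_cases hi : i ∈ B
  · exact ⟨fun _ => (key i hi j₀ hj₀).1, fun _ => hi⟩
  · exact ⟨fun h => absurd h hi, fun h => absurd h (key i₀ hi₀ i hi).2⟩

/-- `vertexForm τ` is nonnegative on the dual cone and, within the boundary, vanishes exactly on
`facet τ`; a common point `w` shows that the value zero is attained on `facet σ`. -/
lemma isExposed_facet_inter_facet (σ τ : Equiv.Perm (Fin n)) :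
    IsExposed ℝ (facet σ) (facet σ ∩ facet τ) := by
  rintro ⟨w, hw, hw'⟩
  refine ⟨-vertexForm τ, ?_⟩
  have hpos : ∀ v ∈ facet σ, 0 ≤ vertexForm τ v := fun v hv =>
    hv.2.ge.trans (minSum_le_vertexForm τ v)
  ext v
  constructor
  · rintro ⟨hv, hv'⟩
    refine ⟨hv, fun y hy => ?_⟩
    simpa [(mem_facet_iff_vertexForm hv'.2).1 hv'] using hpos y hy
  · rintro ⟨hv, hmax⟩
    refine ⟨hv, (mem_facet_iff_vertexForm hv.2).2 (le_antisymm ?_ (hpos v hv))⟩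
    simpa [(mem_facet_iff_vertexForm hw'.2).1 hw'] using hmax w hw

open Classical in
lemma isBoundaryTriangulation_image_flagRay (m : ℕ) :
    IsBoundaryTriangulation (d := m + 1) (permutohedronDualCone (m + 1))
      (Finset.univ.image flagRay) where
  linearIndependent F hF := by
    obtain ⟨σ, -, rfl⟩ := Finset.mem_image.1 hF
    exact linearIndependent_flagRay σ
  extreme F hF i := by
    obtain ⟨σ, -, rfl⟩ := Finset.mem_image.1 hF
    exact isExtremeRayGenerator_ray (prefixSet_succ_nonempty σ i) (prefixSet_succ_ne_univ σ i)
  generator_unique F hF G hG i j h := by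
    obtain ⟨σ, -, rfl⟩ := Finset.mem_image.1 hF
    obtain ⟨τ, -, rfl⟩ := Finset.mem_image.1 hG
    exact congrArg ray (ray_eq_of_sameRay (prefixSet_succ_nonempty σ i)
      (prefixSet_succ_ne_univ σ i) (prefixSet_succ_nonempty τ j) (prefixSet_succ_ne_univ τ j) h)
  cone_injOn F hF G hG h := by
    obtain ⟨σ, -, rfl⟩ := Finset.mem_image.1 hF
    obtain ⟨τ, -, rfl⟩ := Finset.mem_image.1 hG
    have h' : facet σ = facet τ :=
      (spanCone_flagRay σ).symm.trans (Eq.trans h (spanCone_flagRay τ))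
    rw [facet_injective m.succ_pos h']
  iUnion_eq := by
    rw [frontier_permutohedronDualCone m.succ_pos]
    ext v
    simp only [Set.mem_iUnion]
    constructor
    · rintro ⟨F, hF, hv⟩
      obtain ⟨σ, -, rfl⟩ := Finset.mem_image.1 hF
      have hv' : v ∈ facet σ := spanCone_flagRay σ ▸ hv
      exact hv'.2
    · intro hv
      obtain ⟨σ, hσ⟩ := exists_mem_facet hv
      exact ⟨flagRay σ, Finset.mem_image_of_mem _ (Finset.mem_univ σ),
        (spanCone_flagRay σ).symm ▸ hσ⟩
  inter_face F hF G hG := by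
    obtain ⟨σ, -, rfl⟩ := Finset.mem_image.1 hF
    obtain ⟨τ, -, rfl⟩ := Finset.mem_image.1 hG
    have h := isExposed_facet_inter_facet σ τ
    rwa [← spanCone_flagRay σ, ← spanCone_flagRay τ] at h

/-! ### Uniqueness of the triangulation -/

/-- The functional exposing the ray of `v` is nonpositive on `C` and zero at `v`, hence zero at each
`G i` with a nonzero coefficient in `v`. Such a `G i` lies on that ray. -/
lemma exists_eq_smul_of_isExtremeRayGenerator {d k : ℕ} {C : Set (Fin d → ℝ)}
    {G : Fin k → Fin d → ℝ} {v : Fin d → ℝ} (h0 : (0 : Fin d → ℝ) ∈ C) (hG : ∀ i, G i ∈ C)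
    (hG0 : ∀ i, G i ≠ 0) (hv : IsExtremeRayGenerator C v) (hvG : v ∈ spanCone G) :
    ∃ t : ℝ, 0 < t ∧ ∃ i, v = t • G i := by
  obtain ⟨l, hl⟩ := hv.2 ⟨0, 0, le_rfl, (zero_smul ℝ v).symm⟩
  obtain ⟨c, hc, hvc⟩ := mem_spanCone.1 hvG
  have hmem0 : (0 : Fin d → ℝ) ∈ {x ∈ C | ∀ y ∈ C, l y ≤ l x} :=
    hl ▸ ⟨0, le_rfl, (zero_smul ℝ v).symm⟩
  have hmemv : v ∈ {x ∈ C | ∀ y ∈ C, l y ≤ l x} := hl ▸ ⟨1, zero_le_one, (one_smul ℝ v).symm⟩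
  have hle : ∀ y ∈ C, l y ≤ 0 := fun y hy => by simpa using hmem0.2 y hy
  have hlv : l v = 0 := le_antisymm (hle v hmemv.1) (by simpa using hmemv.2 0 h0)
  have hsum : ∑ i, c i * l (G i) = 0 := by
    rw [← hlv, hvc]
    simp
  rw [Finset.sum_eq_zero_iff_of_nonpos
    fun i _ => mul_nonpos_of_nonneg_of_nonpos (hc i) (hle _ (hG i))] at hsum
  obtain ⟨i, hi⟩ : ∃ i, c i ≠ 0 := by
    by_contra! h
    exact hv.1 (by simp [hvc, h])
  have hli : l (G i) = 0 := (mul_eq_zero.1 (hsum i (Finset.mem_univ i))).resolve_left hi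
  have hGi : G i ∈ {x ∈ C | ∀ y ∈ C, l y ≤ l x} := ⟨hG i, fun y hy => (hle y hy).trans_eq hli.symm⟩
  rw [← hl] at hGi
  obtain ⟨t, ht, hGt⟩ := hGi
  have ht' : t ≠ 0 := by
    rintro rfl
    exact hG0 i (by simpa using hGt)
  refine ⟨t⁻¹, inv_pos.2 (ht.lt_of_ne' ht'), i, ?_⟩
  rw [hGt, smul_smul, inv_mul_cancel₀ ht', one_smul]

/-- Every simplicial cone in the boundary that is spanned by extreme rays is a facet. -/
lemma exists_flagRay_of_spanCone_subset_frontier {F : Fin m → Fin (m + 1) → ℝ}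
    (hF : LinearIndependent ℝ F)
    (hext : ∀ i, IsExtremeRayGenerator (permutohedronDualCone (m + 1)) (F i))
    (hfr : spanCone F ⊆ frontier (permutohedronDualCone (m + 1))) :
    ∃ (σ : Equiv.Perm (Fin (m + 1))) (t : Fin m → ℝ) (π : Equiv.Perm (Fin m)),
      (∀ i, 0 < t i) ∧ ∀ i, F i = t i • flagRay σ (π i) := by
  rw [frontier_permutohedronDualCone m.succ_pos] at hfr
  -- The sum of the generators lies in some facet. Since `vertexForm σ` is nonnegative on each
  -- generator and zero on the sum, every generator lies in that facet.
  have hu : ∑ i, F i ∈ spanCone F :=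
    mem_spanCone.2 ⟨fun _ => 1, fun _ => zero_le_one, by simp⟩
  obtain ⟨σ, hσ⟩ := exists_mem_facet (hfr hu)
  have hFi : ∀ i, minSum (F i) = 0 := fun i => hfr (mem_spanCone_self F i)
  have hsum := (mem_facet_iff_vertexForm hσ.2).1 hσ
  rw [map_sum, Finset.sum_eq_zero_iff_of_nonneg
    fun i _ => (hFi i).ge.trans (minSum_le_vertexForm σ (F i))] at hsum
  have hmem : ∀ i, F i ∈ spanCone (flagRay σ) := fun i => by
    rw [spanCone_flagRay, mem_facet_iff_vertexForm (hFi i)]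
    exact hsum i (Finset.mem_univ i)
  choose t ht π hπ using fun i => exists_eq_smul_of_isExtremeRayGenerator
    (mem_permutohedronDualCone.2 (by simpa using (minSum_smul le_rfl (0 : Fin (m + 1) → ℝ)).ge))
    (fun i => mem_permutohedronDualCone.2 (flagRay_mem_facet σ i).2.ge)
    (flagRay_ne_zero σ) (hext i) (hmem i)
  -- Two generators on one ray would be linearly dependent.
  have hinj : Function.Injective π := by
    intro i j hij
    by_contra hne
    have hF' : LinearIndependent ℝ ![F i, F j] := by
      have h := hF.comp ![i, j] fun a b hab => by
        fin_cases a <;> fin_cases b <;> simp_all [eq_comm]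
      convert h using 1
      ext a : 1
      fin_cases a <;> rfl
    have h := LinearIndependent.pair_iff.1 hF' (t j) (-t i) (by
      rw [hπ i, hπ j, hij, smul_smul, smul_smul, neg_mul, neg_smul, mul_comm, add_neg_cancel])
    exact (ht j).ne' h.1
  exact ⟨σ, t, Equiv.ofBijective π (Finite.injective_iff_bijective.1 hinj), ht, hπ⟩

/-! ### The rational function -/

section Specialization

lemma algebraMap_fractionRing_ne_zero {A : Type} [CommRing A] {a : A} (ha : a ≠ 0) :
    algebraMap A (FractionRing A) a ≠ 0 :=
  (map_ne_zero_iff _ (IsFractionRing.injective A (FractionRing A))).mpr ha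

variable {A B : Type} [CommRing A] [IsDomain A] [CommRing B] [IsDomain B] {φ : A →+* B}

lemma SpecializesTo.add {f f' : FractionRing A} {g g' : FractionRing B}
    (h : SpecializesTo φ f g) (h' : SpecializesTo φ f' g') :
    SpecializesTo φ (f + f') (g + g') := by
  obtain ⟨p, q, hq, rfl, rfl⟩ := h
  obtain ⟨p', q', hq', rfl, rfl⟩ := h'
  have q0 : q ≠ 0 := fun h => hq (by rw [h, map_zero])
  have q0' : q' ≠ 0 := fun h => hq' (by rw [h, map_zero])
  refine ⟨p * q' + q * p', q * q', by rw [map_mul]; exact mul_ne_zero hq hq', ?_, ?_⟩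
  · rw [div_add_div _ _ (algebraMap_fractionRing_ne_zero q0) (algebraMap_fractionRing_ne_zero q0')]
    simp only [map_mul, map_add]
  · rw [div_add_div _ _ (algebraMap_fractionRing_ne_zero hq) (algebraMap_fractionRing_ne_zero hq')]
    simp only [map_mul, map_add]

lemma SpecializesTo.zero : SpecializesTo φ 0 0 := ⟨0, 1, by simp, by simp, by simp⟩

lemma SpecializesTo.sum {ι : Type*} (s : Finset ι) {f : ι → FractionRing A}
    {g : ι → FractionRing B} (h : ∀ i ∈ s, SpecializesTo φ (f i) (g i)) :
    SpecializesTo φ (∑ i ∈ s, f i) (∑ i ∈ s, g i) := by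
  classical
  induction s using Finset.induction_on with
  | empty => simpa using SpecializesTo.zero
  | insert i s hi ih =>
    rw [Finset.sum_insert hi, Finset.sum_insert hi]
    exact (h i (Finset.mem_insert_self _ _)).add
      (ih fun j hj => h j (Finset.mem_insert_of_mem hj))

lemma SpecializesTo.one_div_prod {ι : Type*} (s : Finset ι) {q : ι → A}
    (hq : ∀ i ∈ s, φ (q i) ≠ 0) :
    SpecializesTo φ (1 / ∏ i ∈ s, algebraMap A (FractionRing A) (q i))
      (1 / ∏ i ∈ s, algebraMap B (FractionRing B) (φ (q i))) :=
  ⟨1, ∏ i ∈ s, q i, by rw [map_prod]; exact Finset.prod_ne_zero_iff.2 hq, by simp, by simp⟩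

end Specialization

lemma mixedSupportForm_smul {d : ℕ} {ι : Type} [Fintype ι] {P : ι → Set (Fin d → ℝ)}
    {t : ℝ} {v : Fin d → ℝ} (h : ∀ i, supportFn (P i) (t • v) = t * supportFn (P i) v) :
    mixedSupportForm P (t • v) = MvPolynomial.C t * mixedSupportForm P v := by
  simp only [mixedSupportForm, h, Pi.smul_apply, smul_eq_mul, MvPolynomial.C_mul, mul_add,
    Finset.mul_sum, mul_assoc]

lemma supportFn_simplexOf_smul {t : ℝ} (ht : 0 ≤ t) (T : NonemptySubset n) (v : Fin n → ℝ) :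
    supportFn (simplexOf T) (t • v) = t * supportFn (simplexOf T) v := by
  rw [supportFn_simplexOf, supportFn_simplexOf, mul_neg, neg_inj]
  obtain ⟨i, hi, h⟩ := exists_simplexMin T v
  rw [h]
  exact simplexMin_eq hi fun j hj => mul_le_mul_of_nonneg_left (h ▸ simplexMin_le T v hj) ht

lemma sum_restrictToSumZero_X (hn : 0 < n) :
    ∑ T : NonemptySubset n, restrictToSumZero n (MvPolynomial.X (Sum.inl T)) = 0 := by
  have : Nonempty (Fin n) := ⟨⟨0, hn⟩⟩
  let N : NonemptySubset n := ⟨Finset.univ, Finset.univ_nonempty⟩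
  rw [← Fintype.sum_subtype_add_sum_subtype (fun T : NonemptySubset n => T.1 ≠ Finset.univ)]
  have h1 : ∀ T : ProperSubset n, restrictToSumZero n (MvPolynomial.X (Sum.inl T.1)) =
      MvPolynomial.X T := fun T => by
    simp [restrictToSumZero, T.2]
  let u : {T : NonemptySubset n // ¬ T.1 ≠ Finset.univ} := ⟨N, by simp [N]⟩
  rw [Finset.sum_congr rfl fun T _ => h1 T, Fintype.sum_eq_single u]
  · simp [restrictToSumZero, u, N]
  · intro T hT
    exact absurd (Subtype.ext (Subtype.ext (not_not.1 T.2))) hT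

lemma restrictToSumZero_mixedSupportForm_ray (hn : 0 < n) {B : Finset (Fin n)}
    (hB : B ≠ Finset.univ) :
    restrictToSumZero n (mixedSupportForm (simplexOf (n := n)) (ray B)) = -subsetSum B := by
  have hz : ∀ j : Fin n, restrictToSumZero n (MvPolynomial.X (Sum.inr j)) = 0 := fun j => by
    simp [restrictToSumZero]
  have hC : ∀ c, restrictToSumZero n (MvPolynomial.C c) = MvPolynomial.C c := fun c =>
    MvPolynomial.algHom_C _ c
  simp only [mixedSupportForm, map_add, map_sum, map_mul, hz, mul_zero, Finset.sum_const_zero,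
    add_zero, hC, supportFn_simplexOf, simplexMin_ray, map_neg, neg_mul, Finset.sum_neg_distrib,
    add_mul, Finset.sum_add_distrib]
  rw [← Finset.mul_sum, sum_restrictToSumZero_X hn, mul_zero, add_zero, neg_inj,
    ← Fintype.sum_subtype_add_sum_subtype (fun T : NonemptySubset n => T.1 ≠ Finset.univ),
    subsetSum, Finset.sum_filter]
  -- The substituted variable `x_{[n]}` drops out because `[n] ⊄ B`.
  have h0 : ∑ T : {T : NonemptySubset n // ¬ T.1 ≠ Finset.univ},
      MvPolynomial.C (if T.1.1 ⊆ B then (1 : ℝ) else 0) *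
        restrictToSumZero n (MvPolynomial.X (Sum.inl T.1)) = 0 := by
    refine Finset.sum_eq_zero fun T _ => ?_
    rw [not_not.1 T.2, if_neg fun h => hB (Finset.univ_subset_iff.1 h), map_zero, zero_mul]
  rw [h0, add_zero]
  refine Finset.sum_congr rfl fun T _ => ?_
  have : restrictToSumZero n (MvPolynomial.X (Sum.inl T.1)) = MvPolynomial.X T := by
    simp [restrictToSumZero, T.2]
  rw [this]
  split_ifs <;> simp

lemma subsetSum_ne_zero {B : Finset (Fin n)} (hB : B.Nonempty) (hB' : B ≠ Finset.univ) :
    subsetSum B ≠ 0 := by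
  let U : ProperSubset n := ⟨⟨B, hB⟩, hB'⟩
  intro h
  -- At the point `x_B = 1`, all other variables zero, the sum is `1`.
  have h1 := congrArg (MvPolynomial.eval (Pi.single U (1 : ℝ))) h
  simp only [subsetSum, map_sum, map_zero, MvPolynomial.eval_X, Finset.sum_pi_single'] at h1
  simp [U] at h1

/-- The summand of the dual mixed volume function that belongs to one simplicial cone. -/
def coneSummand (F : Fin m → Fin (m + 1) → ℝ) :
    FractionRing (MvPolynomial (NonemptySubset (m + 1) ⊕ Fin (m + 1)) ℝ) :=
  algebraMap (MvPolynomial (NonemptySubset (m + 1) ⊕ Fin (m + 1)) ℝ) _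
      (MvPolynomial.C |(rowsWithOne (d := m + 1) F).det|) /
    ∏ j, algebraMap (MvPolynomial (NonemptySubset (m + 1) ⊕ Fin (m + 1)) ℝ) (FractionRing _)
      (mixedSupportForm simplexOf (F j))

/-- Rescaling the generators multiplies the determinant and the product of the support forms by the
same factor `∏ t i`. -/
lemma coneSummand_eq {F : Fin m → Fin (m + 1) → ℝ} {σ : Equiv.Perm (Fin (m + 1))}
    {t : Fin m → ℝ} (π : Equiv.Perm (Fin m)) (ht : ∀ i, 0 < t i)
    (h : ∀ i, F i = t i • flagRay σ (π i)) :
    coneSummand F = 1 / ∏ j, algebraMap _ (FractionRing _)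
      (mixedSupportForm simplexOf (flagRay σ j)) := by
  have h1 : ∀ j, mixedSupportForm simplexOf (F j) =
      MvPolynomial.C (t j) * mixedSupportForm simplexOf (flagRay σ (π j)) := fun j => by
    rw [h, mixedSupportForm_smul fun T => supportFn_simplexOf_smul (ht j).le T _]
  rw [coneSummand, abs_det_rowsWithOne_smul_perm π ht h, abs_det_rowsWithOne_flagRay, mul_one]
  simp only [h1, map_mul, map_prod, Finset.prod_mul_distrib]
  rw [Equiv.prod_comp π fun j => algebraMap _ (FractionRing _)
    (mixedSupportForm simplexOf (flagRay σ j)), ← div_div, div_self]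
  refine Finset.prod_ne_zero_iff.2 fun j _ => algebraMap_fractionRing_ne_zero ?_
  exact MvPolynomial.C_ne_zero.2 (ht j).ne'

lemma specializesTo_coneSummand_flagRay (σ : Equiv.Perm (Fin (m + 1))) :
    SpecializesTo (restrictToSumZero (m + 1)).toRingHom
      (1 / ∏ j, algebraMap _ (FractionRing _) (mixedSupportForm simplexOf (flagRay σ j)))
      ((-1) ^ m * ∏ a ∈ Finset.Icc 1 m,
        1 / algebraMap (MvPolynomial (ProperSubset (m + 1)) ℝ)
            (FractionRing (MvPolynomial (ProperSubset (m + 1)) ℝ))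
            (subsetSum (prefixSet σ a))) := by
  have h1 : ∀ j : Fin m, (restrictToSumZero (m + 1)).toRingHom
      (mixedSupportForm simplexOf (flagRay σ j)) = -subsetSum (prefixSet σ (j + 1)) := fun j =>
    restrictToSumZero_mixedSupportForm_ray m.succ_pos (prefixSet_succ_ne_univ σ j)
  have h2 := SpecializesTo.one_div_prod (φ := (restrictToSumZero (m + 1)).toRingHom)
    Finset.univ (q := fun j : Fin m => mixedSupportForm simplexOf (flagRay σ j)) fun j _ => by
      rw [h1]
      exact neg_ne_zero.2
        (subsetSum_ne_zero (prefixSet_succ_nonempty σ j) (prefixSet_succ_ne_univ σ j))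
  convert h2 using 1
  simp only [h1, map_neg]
  have h3 : Finset.Icc 1 m = Finset.Ico (0 + 1) (m + 1) := rfl
  rw [h3, ← Finset.prod_Ico_add', ← Finset.range_eq_Ico, Finset.prod_range, Finset.prod_neg,
    Finset.card_univ, Fintype.card_fin, Finset.prod_div_distrib, Finset.prod_const_one,
    one_div, one_div, mul_inv, ← inv_pow, inv_neg, inv_one]

/-- Cones of `𝒯` correspond bijectively to permutations: no cone is listed twice, and the cone
covering an interior point of `facet σ` can only be `facet σ`. -/
lemma hyperplaneDualMixedVolume_eq {𝒯 : Finset (Fin m → Fin (m + 1) → ℝ)}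
    (h𝒯 : IsBoundaryTriangulation (d := m + 1) (permutohedronDualCone (m + 1)) 𝒯) :
    hyperplaneDualMixedVolume (d := m + 1) (simplexOf (n := m + 1)) 𝒯 =
      ∑ σ : Equiv.Perm (Fin (m + 1)), 1 / ∏ j, algebraMap _ (FractionRing _)
        (mixedSupportForm simplexOf (flagRay σ j)) := by
  have hfacet : ∀ F ∈ 𝒯, ∃ (σ : Equiv.Perm (Fin (m + 1))) (t : Fin m → ℝ)
      (π : Equiv.Perm (Fin m)), (∀ i, 0 < t i) ∧ ∀ i, F i = t i • flagRay σ (π i) := by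
    intro F hF
    refine exists_flagRay_of_spanCone_subset_frontier (h𝒯.linearIndependent F hF)
      (h𝒯.extreme F hF) ?_
    rw [← h𝒯.iUnion_eq]
    exact Set.subset_biUnion_of_mem (u := spanCone) hF
  choose! s t π ht hs using hfacet
  have hspan : ∀ F ∈ 𝒯, spanCone F = facet (s F) := fun F hF =>
    (spanCone_eq_of_smul_perm (π F) (ht F hF) (hs F hF)).trans (spanCone_flagRay _)
  change ∑ F ∈ 𝒯, coneSummand F = _
  refine Finset.sum_bij (fun F _ => s F) (fun F _ => Finset.mem_univ _) ?_ ?_ ?_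
  · intro F hF G hG h
    refine h𝒯.cone_injOn hF hG ?_
    exact (hspan F hF).trans (by rw [h]; exact (hspan G hG).symm)
  · intro σ _
    have hfr : facet σ ⊆ ⋃ F ∈ 𝒯, spanCone F := by
      have h : ⋃ F ∈ 𝒯, spanCone F = frontier (permutohedronDualCone (m + 1)) := h𝒯.iUnion_eq
      rw [h, frontier_permutohedronDualCone m.succ_pos]
      exact fun v hv => hv.2
    obtain ⟨v, hv⟩ := exists_strictAnti_mem_facet m.succ_pos σ
    obtain ⟨F, hF, hvF⟩ := Set.mem_iUnion₂.1 (hfr hv.2)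
    rw [hspan F hF] at hvF
    exact ⟨F, hF, (eq_of_strictAnti_comp_of_antitone_comp hv.1 hvF.1).symm⟩
  · intro F hF
    exact coneSummand_eq (π F) (ht F hF) (hs F hF)

end

theorem mainTheorem9 (n : ℕ) (hn : 1 ≤ n) :
    (∃ 𝒯 : Finset (Fin (n - 1) → Fin n → ℝ),
      IsBoundaryTriangulation (permutohedronDualCone n) 𝒯) ∧
    ∀ 𝒯 : Finset (Fin (n - 1) → Fin n → ℝ),
      IsBoundaryTriangulation (permutohedronDualCone n) 𝒯 →
      SpecializesTo (restrictToSumZero n).toRingHom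
        (hyperplaneDualMixedVolume (simplexOf (n := n)) 𝒯)
        ((-1) ^ (n - 1) * ∑ σ : Equiv.Perm (Fin n), ∏ a ∈ Finset.Icc 1 (n - 1),
          1 / algebraMap (MvPolynomial (ProperSubset n) ℝ)
            (FractionRing (MvPolynomial (ProperSubset n) ℝ)) (subsetSum (prefixSet σ a))) := by
  obtain ⟨m, rfl⟩ : ∃ m, n = m + 1 := ⟨n - 1, by omega⟩
  refine ⟨⟨_, isBoundaryTriangulation_image_flagRay m⟩, fun 𝒯 h𝒯 => ?_⟩
  rw [Finset.mul_sum]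
  have h := hyperplaneDualMixedVolume_eq h𝒯
  rw [h]
  exact SpecializesTo.sum _ fun σ _ => specializesTo_coneSummand_flagRay σ
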